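/- All vector spaces are over $\mathbb{C}$. A (right) Leibniz algebra is a vector space $L$ with a bilinear bracket such that $[x,[y,z]]=[[x,y],z]-[[x,z],y]$ for all $x,y,z$. Let $I$ be the two-sided ideal of $L$ generated by all squares $[x,x]$, $x\in L$. The quotient $L/I$ is a Lie algebra, and it acts on $I$ from the right by $x\cdot(l+I)=[x,l]$. **Corollary.** Let $L$ be a finite-dimensional Leibniz algebra, let $s\ge 1$, and suppose that $$L/I\;\cong\; sl_2^1\oplus sl_2^2\oplus\dots\oplus sl_2^s\oplus R$$ as Lie algebras, where each $sl_2^j$ is a copy of $sl_2(\mathbb{C})$ and $R$ is a two-dimensional solvable non-abelian Lie algebra. Suppose that $I$ is irreducible (in particular non-zero) as a right module over $sl_2^1$, and that $\dim I\notin\{1,3\}$ (for irreducible $I$, $\dim I\ne 1$ means that $sl_2^1$ acts non-trivially on $I$). Put $\dim I=m+1$. Then there is $a\in\mathbb{C}$ such that $L$ is isomorphic to the Leibniz algebra with basis $\{e_j,f_j,h_j\ (1\le j\le s),\ x_0,\dots,x_m,\ y_1,y_2\}$ and multiplication table $$\begin{array}{lll} [e_j,h_j]=-[h_j,e_j]=2e_j,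 & [h_j,f_j]=-[f_j,h_j]=2f_j, & \\ {}[e_j,f_j]=-[f_j,e_j]=h_j, & & 1\le j\le s,\\ {}[y_1,y_2]=-[y_2,y_1]=y_1, & & \\ {}[x_k,h_1]=(m-2k)x_k, & & 0\le k\le m,\\ {}[x_k,f_1]=x_{k+1}, & & 0\le k\le m-1,\\ {}[x_k,e_1]=-k(m+1-k)x_{k-1}, & & 1\le k\le m,\\ {}[x_k,y_2]=a\,x_k, & & 0\le k\le m, \end{array}$$ where all products of basis elements that are not listed are zero. -/

import Mathlib

open Module

noncomputable section

/-- A (right) Leibniz algebra over `ℂ`: a complex vector space with a bilinear bracket satisfying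
`[x,[y,z]] = [[x,y],z] - [[x,z],y]`. -/
class LeibnizAlgebra (L : Type*) [AddCommGroup L] [Module ℂ L] extends Bracket L L where
  add_bracket : ∀ x y z : L, ⁅x + y, z⁆ = ⁅x, z⁆ + ⁅y, z⁆
  bracket_add : ∀ x y z : L, ⁅x, y + z⁆ = ⁅x, y⁆ + ⁅x, z⁆
  smul_bracket : ∀ (c : ℂ) (x y : L), ⁅c • x, y⁆ = c • ⁅x, y⁆
  bracket_smul : ∀ (c : ℂ) (x y : L), ⁅x, c • y⁆ = c • ⁅x, y⁆
  leibniz : ∀ x y z : L, ⁅x, ⁅y, z⁆⁆ = ⁅⁅x, y⁆, z⁆ - ⁅⁅x, z⁆, y⁆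

/-- An isomorphism of Leibniz algebras: a linear bijection that preserves the bracket. -/
structure LeibnizEquiv (L L' : Type*) [AddCommGroup L] [Module ℂ L] [LeibnizAlgebra L]
    [AddCommGroup L'] [Module ℂ L'] [LeibnizAlgebra L'] extends L ≃ₗ[ℂ] L' where
  map_bracket : ∀ x y : L, toFun ⁅x, y⁆ = ⁅toFun x, toFun y⁆

namespace LeibnizAlgebra

section Quotient

variable (L : Type*) [AddCommGroup L] [Module ℂ L] [LeibnizAlgebra L]

/-- The bracket of a Leibniz algebra as a bilinear map. -/
def bracketHom : L →ₗ[ℂ] L →ₗ[ℂ] L :=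
  LinearMap.mk₂ ℂ (fun x y => ⁅x, y⁆) add_bracket smul_bracket bracket_add bracket_smul

variable {L}

@[simp] theorem bracketHom_apply (x y : L) : bracketHom L x y = ⁅x, y⁆ := rfl

/-- A two-sided ideal of a Leibniz algebra. -/
def IsIdeal (J : Submodule ℂ L) : Prop :=
  ∀ x ∈ J, ∀ y : L, ⁅x, y⁆ ∈ J ∧ ⁅y, x⁆ ∈ J

variable (L)

/-- The ideal generated by all squares `[x,x]`: the smallest two-sided ideal containing them. -/
def squaresIdeal : Submodule ℂ L :=
  sInf {J : Submodule ℂ L | IsIdeal J ∧ ∀ x : L, ⁅x, x⁆ ∈ J}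

variable {L}

theorem square_mem (x : L) : ⁅x, x⁆ ∈ squaresIdeal L := by
  simp only [squaresIdeal, Submodule.mem_sInf, Set.mem_ofPred_eq]
  exact fun J hJ => hJ.2 x

theorem isIdeal_squaresIdeal : IsIdeal (squaresIdeal L) := by
  intro x hx y
  simp only [squaresIdeal, Submodule.mem_sInf, Set.mem_ofPred_eq] at hx ⊢
  exact ⟨fun J hJ => (hJ.1 x (hx J hJ) y).1, fun J hJ => (hJ.1 x (hx J hJ) y).2⟩

/-- The ideal generated by squares annihilates the algebra from the right. -/
theorem bracket_eq_zero_of_mem (x : L) {z : L} (hz : z ∈ squaresIdeal L) : ⁅x, z⁆ = 0 := by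
  let Z : Submodule ℂ L := LinearMap.ker (bracketHom L).flip
  have hZ : ∀ w : L, w ∈ Z ↔ ∀ v : L, ⁅v, w⁆ = 0 := by
    intro w
    simp only [Z, LinearMap.mem_ker, LinearMap.ext_iff]
    rfl
  have hzero : ∀ v : L, ⁅(0 : L), v⁆ = 0 := fun v =>
    congrArg (fun g : L →ₗ[ℂ] L => g v) (map_zero (bracketHom L))
  have key : z ∈ Z := by
    have : squaresIdeal L ≤ Z := by
      refine sInf_le ⟨fun w hw y => ?_, fun w => ?_⟩
      · rw [hZ] at hw
        refine ⟨(hZ _).2 fun v => ?_, (hZ _).2 fun v => ?_⟩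
        · rw [leibniz, hw, hw, hzero, sub_zero]
        · rw [leibniz, hw, hw, hzero, sub_zero]
      · exact (hZ _).2 fun v => by rw [leibniz, sub_self]
    exact this hz
  exact (hZ z).1 key x

variable (L)

/-- The quotient `L/I` of a Leibniz algebra by the ideal `I` generated by squares. -/
def AssocLie : Type _ := L ⧸ squaresIdeal L

instance : AddCommGroup (AssocLie L) := inferInstanceAs (AddCommGroup (L ⧸ squaresIdeal L))
instance : Module ℂ (AssocLie L) := inferInstanceAs (Module ℂ (L ⧸ squaresIdeal L))

/-- The natural epimorphism `L → L/I`. -/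
def toAssocLie : L →ₗ[ℂ] AssocLie L := (squaresIdeal L).mkQ

/-- The bracket induced on `L/I`: `[x + I, y + I] = [x,y] + I`. -/
def quotBracket : AssocLie L →ₗ[ℂ] AssocLie L →ₗ[ℂ] AssocLie L :=
  (squaresIdeal L).liftQ
    (LinearMap.flip ((squaresIdeal L).liftQ
      ((bracketHom L).compr₂ (toAssocLie L)).flip
      (fun z hz => by
        refine LinearMap.ext fun x => ?_
        exact (Submodule.Quotient.mk_eq_zero _).2 (isIdeal_squaresIdeal z hz x).2)))
    (fun z hz => by
      refine LinearMap.ext fun q => ?_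
      obtain ⟨y, rfl⟩ := (squaresIdeal L).mkQ_surjective q
      exact (Submodule.Quotient.mk_eq_zero _).2 (isIdeal_squaresIdeal z hz y).1)

theorem quotBracket_mk (x y : L) :
    quotBracket L (toAssocLie L x) (toAssocLie L y) = toAssocLie L ⁅x, y⁆ := rfl

theorem toAssocLie_surjective : Function.Surjective (toAssocLie L) :=
  (squaresIdeal L).mkQ_surjective

theorem quotBracket_self (q : AssocLie L) : quotBracket L q q = 0 := by
  obtain ⟨x, rfl⟩ := toAssocLie_surjective L q
  exact (Submodule.Quotient.mk_eq_zero _).2 (square_mem x)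

theorem quotBracket_skew (p q : AssocLie L) : quotBracket L p q = - quotBracket L q p := by
  have h := quotBracket_self L (p + q)
  simp only [map_add, LinearMap.add_apply, quotBracket_self, zero_add, add_zero] at h
  exact eq_neg_of_add_eq_zero_right h

/-- `L/I` is a Lie algebra. -/
instance : LieRing (AssocLie L) where
  bracket p q := quotBracket L p q
  add_lie p q r := by simp
  lie_add p q r := by simp
  lie_self p := quotBracket_self L p
  leibniz_lie p q r := by
    change quotBracket L p (quotBracket L q r) =
      quotBracket L (quotBracket L p q) r + quotBracket L q (quotBracket L p r)
    rw [quotBracket_skew L q (quotBracket L p r), ← sub_eq_add_neg]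
    obtain ⟨x, rfl⟩ := toAssocLie_surjective L p
    obtain ⟨y, rfl⟩ := toAssocLie_surjective L q
    obtain ⟨z, rfl⟩ := toAssocLie_surjective L r
    simp only [quotBracket_mk, ← map_sub, leibniz]

instance : LieAlgebra ℂ (AssocLie L) where
  lie_smul c p q := map_smul (quotBracket L p) c q

/-- The right action of the Lie algebra `L/I` on `I`: the class of `l` sends `x ∈ I` to `[x,l]`. -/
def rightAction : AssocLie L →ₗ[ℂ] squaresIdeal L →ₗ[ℂ] squaresIdeal L :=
  (squaresIdeal L).liftQ
    (LinearMap.mk₂ ℂ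
      (fun (l : L) (x : squaresIdeal L) =>
        (⟨⁅(x : L), l⁆, (isIdeal_squaresIdeal x.1 x.2 l).1⟩ : squaresIdeal L))
      (fun l l' x => Subtype.ext (bracket_add _ _ _))
      (fun c l x => Subtype.ext (bracket_smul _ _ _))
      (fun l x x' => Subtype.ext (add_bracket _ _ _))
      (fun c l x => Subtype.ext (smul_bracket _ _ _)))
    (fun z hz => by
      refine LinearMap.ext fun x => Subtype.ext ?_
      exact bracket_eq_zero_of_mem (x : L) hz)

theorem rightAction_mk (l : L) (x : squaresIdeal L) :
    (rightAction L (toAssocLie L l) x : L) = ⁅(x : L), l⁆ := rfl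

/-- `I` is irreducible as a right module over the subset (usually a subalgebra) `S` of `L/I`:
it is nonzero, and its only `S`-invariant subspaces are `0` and `I`. -/
def SquaresIdealIrreducibleOver (S : Set (AssocLie L)) : Prop :=
  Nontrivial (squaresIdeal L) ∧
    ∀ N : Submodule ℂ (squaresIdeal L),
      (∀ u ∈ S, ∀ x ∈ N, rightAction L u x ∈ N) → N = ⊥ ∨ N = ⊤

end Quotient

section Model

/-- Labels of the basis `e_j, f_j, h_j` (`j` in `Fin s`), `x_0, …, x_m`, `y_1, y_2`. The copies of
`sl₂` are numbered from `0`, so that the first one has index `0`. -/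
inductive BasisIndex (s m : ℕ) : Type
  | e (j : Fin s) : BasisIndex s m
  | f (j : Fin s) : BasisIndex s m
  | h (j : Fin s) : BasisIndex s m
  | x (k : Fin (m + 1)) : BasisIndex s m
  | y₁ : BasisIndex s m
  | y₂ : BasisIndex s m

open BasisIndex Finsupp

/-- The vector `x_k`, read as `0` if `k > m`. -/
def xvec (s m k : ℕ) : BasisIndex s m →₀ ℂ :=
  if hk : k < m + 1 then single (x ⟨k, hk⟩) 1 else 0

/-- The multiplication table of the algebra with parameter `a`, on basis vectors. -/
def table (s m : ℕ) [NeZero s] (a : ℂ) :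
    BasisIndex s m → BasisIndex s m → (BasisIndex s m →₀ ℂ)
  | e i, h j => if i = j then single (e i) 2 else 0
  | h i, e j => if i = j then single (e i) (-2) else 0
  | h i, f j => if i = j then single (f i) 2 else 0
  | f i, h j => if i = j then single (f i) (-2) else 0
  | e i, f j => if i = j then single (h i) 1 else 0
  | f i, e j => if i = j then single (h i) (-1) else 0
  | y₁, y₂ => single y₁ 1
  | y₂, y₁ => single y₁ (-1)
  | x k, h j => if j = 0 then ((m : ℂ) - 2 * (k : ℕ)) • xvec s m k else 0
  | x k, f j => if j = 0 then xvec s m (k + 1) else 0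
  | x k, e j => if j = 0 then
      (-((k : ℕ) : ℂ) * ((m : ℂ) + 1 - (k : ℕ))) • xvec s m (k - 1) else 0
  | x k, y₂ => a • xvec s m k
  | _, _ => 0

/-- The vector space with basis `e_j, f_j, h_j, x_k, y_1, y_2`, on which the bracket with
parameter `a` lives. -/
def Model (s m : ℕ) (_a : ℂ) : Type := BasisIndex s m →₀ ℂ

variable (s m : ℕ) (a : ℂ)

instance : AddCommGroup (Model s m a) := inferInstanceAs (AddCommGroup (BasisIndex s m →₀ ℂ))
instance : Module ℂ (Model s m a) := inferInstanceAs (Module ℂ (BasisIndex s m →₀ ℂ))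

variable [NeZero s]

/-- The bilinear extension of the multiplication table. -/
def tableBracket :
    (BasisIndex s m →₀ ℂ) →ₗ[ℂ] (BasisIndex s m →₀ ℂ) →ₗ[ℂ] (BasisIndex s m →₀ ℂ) :=
  Finsupp.lift _ ℂ _ fun p => Finsupp.lift _ ℂ _ fun q => table s m a p q

theorem tableBracket_single (p q : BasisIndex s m) (c d : ℂ) :
    tableBracket s m a (single p c) (single q d) = (c * d) • table s m a p q := by
  simp [tableBracket, mul_smul]


theorem tableBracket_single_xvec (p : BasisIndex s m) (c : ℂ) (k : ℕ) :
    tableBracket s m a (single p c) (xvec s m k) = 0 := by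
  unfold xvec
  split_ifs with hk
  · rw [tableBracket_single]; cases p <;> simp [table]
  · simp

theorem tableBracket_xvec_h (k : ℕ) (j : Fin s) (c : ℂ) :
    tableBracket s m a (xvec s m k) (single (h j) c) =
      if j = 0 then (c * ((m : ℂ) - 2 * k)) • xvec s m k else 0 := by
  unfold xvec
  split_ifs with hk h0 h0 <;> simp_all [tableBracket_single, table, xvec, mul_smul]

theorem tableBracket_xvec_f (k : ℕ) (j : Fin s) (c : ℂ) :
    tableBracket s m a (xvec s m k) (single (f j) c) =
      if j = 0 then c • xvec s m (k + 1) else 0 := by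
  by_cases hk : k < m + 1
  · have : xvec s m k = single (x ⟨k, hk⟩) 1 := by simp [xvec, hk]
    rw [this, tableBracket_single]
    split_ifs with h0 <;> simp [table, h0]
  · have h1 : xvec s m k = 0 := by simp [xvec, hk]
    have h2 : xvec s m (k + 1) = 0 := by
      have : ¬ k + 1 < m + 1 := by omega
      simp only [xvec, this, dite_false]
    simp [h1, h2]

theorem tableBracket_xvec_e (k : ℕ) (hkm : k ≤ m + 1) (j : Fin s) (c : ℂ) :
    tableBracket s m a (xvec s m k) (single (e j) c) =
      if j = 0 then (c * (-(k : ℂ) * ((m : ℂ) + 1 - k))) • xvec s m (k - 1) else 0 := by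
  by_cases hk : k < m + 1
  · have : xvec s m k = single (x ⟨k, hk⟩) 1 := by simp [xvec, hk]
    rw [this, tableBracket_single]
    split_ifs with h0 <;> simp [table, h0, smul_smul]
  · have h1 : xvec s m k = 0 := by simp [xvec, hk]
    obtain rfl : k = m + 1 := by omega
    simp [h1]

theorem tableBracket_xvec_y₁ (k : ℕ) (c : ℂ) :
    tableBracket s m a (xvec s m k) (single y₁ c) = 0 := by
  unfold xvec
  split_ifs with hk <;> simp [tableBracket_single, table]

theorem tableBracket_xvec_y₂ (k : ℕ) (c : ℂ) :
    tableBracket s m a (xvec s m k) (single y₂ c) = (c * a) • xvec s m k := by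
  unfold xvec
  split_ifs with hk <;> simp [tableBracket_single, table, xvec, hk]

theorem tableBracket_xvec_x (k : ℕ) (l : Fin (m + 1)) (c : ℂ) :
    tableBracket s m a (xvec s m k) (single (x l) c) = 0 := by
  unfold xvec
  split_ifs with hk <;> simp [tableBracket_single, table]

set_option maxHeartbeats 4000000 in
theorem table_leibniz (p q r : BasisIndex s m) :
    tableBracket s m a (single p 1) (table s m a q r) =
      tableBracket s m a (table s m a p q) (single r 1)
        - tableBracket s m a (table s m a p r) (single q 1) := by
  have e2 : ∀ k : Fin (m + 1), (k : ℕ) ≤ m + 1 + 1 := fun k => by omega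
  have e3 : ∀ k : Fin (m + 1), (k : ℕ) ≤ m := fun k => by omega
  rcases p with i | i | i | k | _ | _ <;> rcases q with j | j | j | l | _ | _ <;>
    rcases r with t | t | t | n | _ | _ <;>
    simp only [table] <;> (try split_ifs) <;> (try subst_vars) <;>
    (try simp_all [tableBracket_single, tableBracket_single_xvec, tableBracket_xvec_h,
      tableBracket_xvec_f, tableBracket_xvec_e, tableBracket_xvec_y₁, tableBracket_xvec_y₂,
      tableBracket_xvec_x, table, smul_smul]) <;>
    (try (intro ht; exact absurd ht.symm (by assumption))) <;>
    (try module) <;>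
    (obtain ⟨k, hk⟩ := k; rcases k with _ | k <;> simp <;> module)

theorem tableBracket_leibniz (u v w : BasisIndex s m →₀ ℂ) :
    tableBracket s m a u (tableBracket s m a v w) =
      tableBracket s m a (tableBracket s m a u v) w
        - tableBracket s m a (tableBracket s m a u w) v := by
  have key := table_leibniz s m a
  have hs : ∀ p q, table s m a p q = tableBracket s m a (single p 1) (single q 1) := by
    intro p q
    rw [tableBracket_single, one_mul, one_smul]
  simp only [hs] at key
  generalize tableBracket s m a = B at key ⊢
  induction u using Finsupp.induction_linear with
  | zero => simp only [map_zero, LinearMap.zero_apply, sub_zero]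
  | add u u' hu hu' => simp only [map_add, LinearMap.add_apply, hu, hu']; abel
  | single p c =>
    induction v using Finsupp.induction_linear with
    | zero => simp only [map_zero, LinearMap.zero_apply, sub_zero]
    | add v v' hv hv' => simp only [map_add, LinearMap.add_apply, hv, hv']; abel
    | single q d =>
      induction w using Finsupp.induction_linear with
      | zero => simp only [map_zero, LinearMap.zero_apply, sub_zero]
      | add w w' hw hw' => simp only [map_add, LinearMap.add_apply, hw, hw']; abel
      | single r b =>
        have h1 : ∀ (i : BasisIndex s m) (z : ℂ), single i z = z • single i (1 : ℂ) := by
          simp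
        rw [h1 p c, h1 q d, h1 r b]
        simp only [map_smul, LinearMap.smul_apply, key]
        module

/-- The algebra with the given multiplication table. -/
instance : LeibnizAlgebra (Model s m a) where
  bracket u v := tableBracket s m a u v
  add_bracket u v w := LinearMap.map_add₂ (tableBracket s m a) u v w
  bracket_add u v w := map_add (tableBracket s m a u) v w
  smul_bracket c u v := LinearMap.map_smul₂ (tableBracket s m a) c u v
  bracket_smul c u v := map_smul (tableBracket s m a u) c v
  leibniz u v w := tableBracket_leibniz s m a u v w

end Model

end LeibnizAlgebra

end

/-! Write `𝔤` for `L/I`. Since `[L, I] = 0`, the algebra `L` is an extension of the Lie algebra `𝔤`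
by `I`, a left `𝔤`-module under `q·x = -[x, q]`. A linear section `σ` of `L → 𝔤` has a defect
`D(q)(p) = [σp, σq] - σ[p, q]` in `I`, and the Leibniz identity says that `D` is a 1-cocycle of `𝔤`
with values in `Hom(𝔤, I)` (`sectionDefect_cocycle`). If `D` is the coboundary of `T`, then `σ + T`
is multiplicative and `L` splits (`exists_multiplicative_section`).

The cohomology vanishes because of the first `sl₂` alone. Over it `𝔤` is the adjoint module plus
trivial ones, so an irreducible `I` of dimension other than 1 and 3 admits no nonzero equivariant
map `𝔤 → I` (`hom_eq_zero_of_invariant`). Hence the Casimir operator is invertible on `Hom(𝔤, I)`,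
which makes every cocycle a coboundary along this `sl₂`. On its centralizer the corrected cocycle
takes invariant values, hence is zero (`cocycle_eq_coboundary`).

It remains to know the action on `I`. The first `sl₂` acts through a highest weight basis.
Everything commuting with it acts by scalars (Schur), so brackets of such elements act by zero: this
kills the other copies of `sl₂` and `y₁`, and leaves the scalar `a` of `y₂`. -/

namespace IsSl2Triple

/-! ### Modules over an `sl₂`-triple: primitive vectors, the Casimir operator, 1-cocycles. -/

section Modules

variable {𝔤 M : Type*} [LieRing 𝔤] [LieAlgebra ℂ 𝔤] [AddCommGroup M] [Module ℂ M]
  [LieRingModule 𝔤 M] [LieModule ℂ 𝔤 M] {h e f : 𝔤}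

/-- With the next two lemmas, a rewriting system that puts words in `e`, `f`, `h` acting on a vector
into the order `f`, `e`, `h`. The Casimir identities below then become linear and fall to `module`.
-/
theorem lie_e_lie_f {𝔤 M : Type*} [LieRing 𝔤] [AddCommGroup M] [LieRingModule 𝔤 M] {h e f : 𝔤}
    (t : IsSl2Triple h e f) (v : M) : ⁅e, ⁅f, v⁆⁆ = ⁅h, v⁆ + ⁅f, ⁅e, v⁆⁆ := by
  rw [leibniz_lie, t.lie_e_f]

theorem lie_h_lie_e (t : IsSl2Triple h e f) (v : M) :
    ⁅h, ⁅e, v⁆⁆ = (2 : ℂ) • ⁅e, v⁆ + ⁅e, ⁅h, v⁆⁆ := by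
  rw [leibniz_lie, t.lie_h_e_smul ℂ, smul_lie]

theorem lie_h_lie_f (t : IsSl2Triple h e f) (v : M) :
    ⁅h, ⁅f, v⁆⁆ = -((2 : ℂ) • ⁅f, v⁆) + ⁅f, ⁅h, v⁆⁆ := by
  rw [leibniz_lie, t.lie_lie_smul_f ℂ, neg_lie, smul_lie]

/-- A nonzero subspace stable under `h` and `e` contains a primitive vector. -/
theorem exists_hasPrimitiveVectorWith_mem [FiniteDimensional ℂ M] (t : IsSl2Triple h e f)
    {N : Submodule ℂ M} (hN : N ≠ ⊥) (hh : ∀ x ∈ N, ⁅h, x⁆ ∈ N) (he : ∀ x ∈ N, ⁅e, x⁆ ∈ N) :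
    ∃ (μ : ℂ) (v : M), v ∈ N ∧ t.HasPrimitiveVectorWith v μ := by
  have : Nontrivial N := Submodule.nontrivial_iff_ne_bot.2 hN
  let H : Module.End ℂ N := (LieModule.toEnd ℂ 𝔤 M h).restrict hh
  obtain ⟨μ, hμ⟩ := Module.End.exists_eigenvalue H
  obtain ⟨m₀, hm₀⟩ := hμ.exists_hasEigenvector
  have hm : ⁅h, (m₀ : M)⁆ = μ • (m₀ : M) := congrArg Subtype.val hm₀.apply_eq_smul
  have hm0 : (m₀ : M) ≠ 0 := fun h0 => hm₀.2 (Subtype.ext h0)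
  let u (n : ℕ) : M := ((LieModule.toEnd ℂ 𝔤 M e) ^ n) (m₀ : M)
  have hmem : ∀ n, u n ∈ N := by
    intro n
    induction n with
    | zero => exact m₀.2
    | succ n ih =>
      have : u (n + 1) = ⁅e, u n⁆ := (lie_e_pow_toEnd_e n).symm
      rw [this]
      exact he _ ih
  have hzero : ∃ k, u k = 0 := by
    -- Otherwise the `u n` would be infinitely many eigenvectors of `h` with distinct eigenvalues `μ
    -- + 2n`.
    by_contra! contra
    have hli := Module.End.eigenvectors_linearIndependent' (LieModule.toEnd ℂ 𝔤 M h)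
      (fun n : ℕ => μ + 2 * (n : ℂ)) (fun a b hab => by simpa using hab) u fun n =>
        ⟨Module.End.mem_eigenspace_iff.2 (t.lie_h_pow_toEnd_e hm n), contra n⟩
    exact not_finite_iff_infinite.2 inferInstance (hli.finite : Finite ℕ)
  obtain ⟨n, hn, hn'⟩ := Nat.exists_not_and_succ_of_not_zero_of_exists (p := fun k => u k = 0)
    hm0 hzero
  exact ⟨μ + 2 * n, u n, hmem n, ⟨hn, t.lie_h_pow_toEnd_e hm n, by
    rw [← hn']; exact lie_e_pow_toEnd_e n⟩⟩

/-- The Casimir operator `ef + fe + h²/2`. -/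
noncomputable def casimir (_t : IsSl2Triple h e f) (M : Type*) [AddCommGroup M] [Module ℂ M]
    [LieRingModule 𝔤 M] [LieModule ℂ 𝔤 M] : Module.End ℂ M :=
  LieModule.toEnd ℂ 𝔤 M e * LieModule.toEnd ℂ 𝔤 M f +
    LieModule.toEnd ℂ 𝔤 M f * LieModule.toEnd ℂ 𝔤 M e +
    (1 / 2 : ℂ) • (LieModule.toEnd ℂ 𝔤 M h * LieModule.toEnd ℂ 𝔤 M h)

theorem casimir_apply (t : IsSl2Triple h e f) (v : M) :
    t.casimir M v = ⁅e, ⁅f, v⁆⁆ + ⁅f, ⁅e, v⁆⁆ + (1 / 2 : ℂ) • ⁅h, ⁅h, v⁆⁆ := rfl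

theorem casimir_lie_e (t : IsSl2Triple h e f) (v : M) :
    t.casimir M ⁅e, v⁆ = ⁅e, t.casimir M v⁆ := by
  simp only [casimir_apply, lie_add, lie_smul, t.lie_e_lie_f, t.lie_h_lie_e]
  module

theorem casimir_lie_f (t : IsSl2Triple h e f) (v : M) :
    t.casimir M ⁅f, v⁆ = ⁅f, t.casimir M v⁆ := by
  simp only [casimir_apply, lie_add, lie_neg, lie_smul, t.lie_e_lie_f, t.lie_h_lie_f]
  module

theorem casimir_lie_h (t : IsSl2Triple h e f) (v : M) :
    t.casimir M ⁅h, v⁆ = ⁅h, t.casimir M v⁆ := by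
  simp only [casimir_apply, lie_add, lie_smul, t.lie_e_lie_f, t.lie_h_lie_f,
    t.lie_h_lie_e]
  module

/-- The Casimir operator is injective on a module without nonzero invariants. -/
theorem casimir_injective [FiniteDimensional ℂ M] (t : IsSl2Triple h e f)
    (hM : ∀ v : M, ⁅e, v⁆ = 0 → ⁅f, v⁆ = 0 → ⁅h, v⁆ = 0 → v = 0) :
    Function.Injective (t.casimir M) := by
  rw [← LinearMap.ker_eq_bot]
  by_contra hK
  -- The kernel of the Casimir operator is stable under the triple, so if nonzero it contains a
  -- primitive vector.
  obtain ⟨μ, v, hv, P⟩ := t.exists_hasPrimitiveVectorWith_mem hK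
    (fun x hx => by
      rw [LinearMap.mem_ker] at hx ⊢
      rw [casimir_lie_h, hx, lie_zero])
    (fun x hx => by
      rw [LinearMap.mem_ker] at hx ⊢
      rw [casimir_lie_e, hx, lie_zero])
  obtain ⟨n, rfl⟩ := P.exists_nat
  -- The Casimir operator acts on a primitive vector of weight `n` by `n(n+2)/2`. Its vanishing
  -- forces `n = 0`, and a primitive vector of weight 0 is invariant.
  have hC : ((n : ℂ) * (n + 2)) • v = 0 := by
    have h1 := LinearMap.mem_ker.1 hv
    simp only [casimir_apply, t.lie_e_lie_f, P.lie_e, P.lie_h, lie_zero, lie_smul] at h1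
    have h2 : ((n : ℂ) * (n + 2)) • v =
        (2 : ℂ) • ((n : ℂ) • v + 0 + 0 + (1 / 2 : ℂ) • (n : ℂ) • (n : ℂ) • v) := by
      module
    rw [h2, h1, smul_zero]
  have hn : n = 0 := by
    rcases smul_eq_zero.1 hC with h0 | h0
    · have : n * (n + 2) = 0 := by exact_mod_cast h0
      simpa using this
    · exact absurd h0 P.ne_zero
  subst hn
  have hf := P.pow_toEnd_f_eq_zero_of_eq_nat rfl
  exact P.ne_zero (hM v P.lie_e (by simpa using hf) (by simpa using P.lie_h))

/-- A Lie algebra `1`-cocycle is a coboundary along an `sl₂`-triple whose Casimir operator is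
injective. -/
theorem exists_eq_lie_of_cocycle [FiniteDimensional ℂ M] (t : IsSl2Triple h e f)
    (hC : Function.Injective (t.casimir M)) (D : 𝔤 →ₗ[ℂ] M)
    (hD : ∀ y z, D ⁅y, z⁆ = ⁅y, D z⁆ - ⁅z, D y⁆) :
    ∃ m : M, D e = ⁅e, m⁆ ∧ D f = ⁅f, m⁆ ∧ D h = ⁅h, m⁆ := by
  -- The choice is forced: if `D y = y·m` for the three elements, the right-hand side is the Casimir
  -- operator applied to `m`.
  obtain ⟨m, hm⟩ := LinearMap.surjective_of_injective hC
    (⁅e, D f⁆ + ⁅f, D e⁆ + (1 / 2 : ℂ) • ⁅h, D h⁆)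
  have h1 : ⁅e, D f⁆ = D h + ⁅f, D e⁆ := by
    rw [← t.lie_e_f, hD]; abel
  have h2 : ⁅h, D e⁆ = (2 : ℂ) • D e + ⁅e, D h⁆ := by
    rw [← map_smul, ← t.lie_h_e_smul ℂ, hD]; abel
  have h3 : ⁅h, D f⁆ = -((2 : ℂ) • D f) + ⁅f, D h⁆ := by
    rw [← map_smul, ← map_neg, ← t.lie_lie_smul_f ℂ, hD]; abel
  -- As the Casimir operator is injective and commutes with the action, each equation may be checked
  -- after applying it. The identities `h1`, `h2`, `h3` are the cocycle rule on the three brackets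
  -- of the triple.
  refine ⟨m, hC ?_, hC ?_, hC ?_⟩
  · rw [casimir_lie_e, hm]
    simp only [casimir_apply, lie_add, lie_smul, t.lie_e_lie_f, t.lie_h_lie_e, h1, h2]
    module
  · rw [casimir_lie_f, hm]
    simp only [casimir_apply, lie_add, lie_neg, lie_smul, t.lie_e_lie_f, t.lie_h_lie_f, h1, h3]
    module
  · rw [casimir_lie_h, hm]
    simp only [casimir_apply, lie_add, lie_smul, t.lie_e_lie_f, t.lie_h_lie_f, h1, h2]
    module

/-- If `𝔤` is the sum of an `sl₂` and its centralizer, and the `𝔤`-module `M` has no nonzero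
`sl₂`-invariants, then every `1`-cocycle of `𝔤` with values in `M` is a coboundary. -/
theorem cocycle_eq_coboundary [FiniteDimensional ℂ M] (t : IsSl2Triple h e f)
    (hM : ∀ v : M, ⁅e, v⁆ = 0 → ⁅f, v⁆ = 0 → ⁅h, v⁆ = 0 → v = 0)
    (hdec : ∀ y : 𝔤, ∃ (a b c : ℂ) (z : 𝔤), y = a • e + b • f + c • h + z ∧
      ⁅e, z⁆ = 0 ∧ ⁅f, z⁆ = 0 ∧ ⁅h, z⁆ = 0)
    (D : 𝔤 →ₗ[ℂ] M) (hD : ∀ y z, D ⁅y, z⁆ = ⁅y, D z⁆ - ⁅z, D y⁆) :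
    ∃ m : M, ∀ y, D y = ⁅y, m⁆ := by
  obtain ⟨m, he, hf, hh⟩ := t.exists_eq_lie_of_cocycle (t.casimir_injective hM) D hD
  refine ⟨m, fun y => ?_⟩
  obtain ⟨a, b, c, z, rfl, hez, hfz, hhz⟩ := hdec y
  -- The cocycle rule on `[x, z] = 0` gives `x·D z = z·D x = z·x·m = x·z·m`.
  have hz : ∀ x, ⁅x, z⁆ = 0 → D x = ⁅x, m⁆ → ⁅x, D z - ⁅z, m⁆⁆ = 0 := by
    intro x hxz hx
    have h1 := hD x z
    rw [hxz, map_zero, hx] at h1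
    rw [lie_sub, leibniz_lie x z m, hxz, zero_lie, zero_add, ← h1]
  have hz0 := hM _ (hz e hez he) (hz f hfz hf) (hz h hhz hh)
  simp only [map_add, map_smul, add_lie, smul_lie, he, hf, hh, sub_eq_zero.1 hz0]

/-- A primitive vector of an irreducible module generates a basis. -/
theorem HasPrimitiveVectorWith.exists_basis [FiniteDimensional ℂ M] {t : IsSl2Triple h e f}
    {v : M} {μ : ℂ} (P : t.HasPrimitiveVectorWith v μ)
    (hirr : ∀ N : Submodule ℂ M,
      (∀ x ∈ N, ⁅e, x⁆ ∈ N ∧ ⁅f, x⁆ ∈ N ∧ ⁅h, x⁆ ∈ N) → N = ⊥ ∨ N = ⊤) :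
    ∃ (n : ℕ) (b : Basis (Fin (n + 1)) ℂ M), μ = n ∧
      ∀ k : Fin (n + 1), b k = ((LieModule.toEnd ℂ 𝔤 M f) ^ (k : ℕ)) v := by
  obtain ⟨n, rfl⟩ := P.exists_nat
  let u : Fin (n + 1) → M := fun k => ((LieModule.toEnd ℂ 𝔤 M f) ^ (k : ℕ)) v
  have hli : LinearIndependent ℂ u := by
    refine Module.End.eigenvectors_linearIndependent' (LieModule.toEnd ℂ 𝔤 M h)
      (fun k : Fin (n + 1) => (n : ℂ) - 2 * ((k : ℕ) : ℂ)) (fun a b hab => ?_) u fun k => ?_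
    · exact Fin.ext (by simpa using hab)
    · exact ⟨Module.End.mem_eigenspace_iff.2 (P.lie_h_pow_toEnd_f k),
        P.pow_toEnd_f_ne_zero_of_eq_nat rfl (Nat.lt_succ_iff.1 k.2)⟩
  -- The span of the string `f^k v` is stable under the triple and contains `v`, so irreducibility
  -- makes it everything.
  have hspan : Submodule.span ℂ (Set.range u) = ⊤ := by
    have hu : ∀ k : ℕ, k ≤ n →
        ((LieModule.toEnd ℂ 𝔤 M f) ^ k) v ∈ Submodule.span ℂ (Set.range u) := fun k hk =>
      Submodule.subset_span ⟨⟨k, Nat.lt_succ_iff.2 hk⟩, rfl⟩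
    have hgen : ∀ x : 𝔤, (∀ k, ⁅x, u k⁆ ∈ Submodule.span ℂ (Set.range u)) →
        ∀ w ∈ Submodule.span ℂ (Set.range u), ⁅x, w⁆ ∈ Submodule.span ℂ (Set.range u) := by
      intro x hx w hw
      induction hw using Submodule.span_induction with
      | zero => rw [lie_zero]; exact zero_mem _
      | add a b _ _ ha hb => rw [lie_add]; exact add_mem ha hb
      | smul c a _ ha => rw [lie_smul]; exact Submodule.smul_mem _ c ha
      | mem a ha => obtain ⟨k, rfl⟩ := ha; exact hx k
    refine (hirr _ fun w hw => ⟨hgen e (fun k => ?_) w hw, hgen f (fun k => ?_) w hw,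
      hgen h (fun k => ?_) w hw⟩).resolve_left ?_
    · obtain ⟨k, hk⟩ := k
      rcases k with _ | k
      · change ⁅e, v⁆ ∈ _
        rw [P.lie_e]; exact zero_mem _
      · change ⁅e, ((LieModule.toEnd ℂ 𝔤 M f) ^ (k + 1)) v⁆ ∈ _
        rw [P.lie_e_pow_succ_toEnd_f]
        exact Submodule.smul_mem _ _ (hu k (by omega))
    · change ⁅f, ((LieModule.toEnd ℂ 𝔤 M f) ^ (k : ℕ)) v⁆ ∈ _
      rw [P.lie_f_pow_toEnd_f]
      rcases (Nat.lt_succ_iff.1 k.2).lt_or_eq with hk | hk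
      · exact hu _ hk
      · rw [hk, P.pow_toEnd_f_eq_zero_of_eq_nat rfl]; exact zero_mem _
    · change ⁅h, ((LieModule.toEnd ℂ 𝔤 M f) ^ (k : ℕ)) v⁆ ∈ _
      rw [P.lie_h_pow_toEnd_f]
      exact Submodule.smul_mem _ _ (hu _ (Nat.lt_succ_iff.1 k.2))
    · intro hbot
      have := hu 0 (Nat.zero_le n)
      rw [hbot, Submodule.mem_bot] at this
      exact P.ne_zero this
  exact ⟨n, Basis.mk hli hspan.ge, rfl, fun k => Basis.mk_apply hli hspan.ge k⟩

/-- Let `V` be irreducible over an `sl₂` with `dim V ∉ {1, 3}`. If `𝔤` is the sum of this `sl₂`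
and its centralizer, then `Hom(𝔤, V)` has no nonzero `sl₂`-invariants. -/
theorem hom_eq_zero_of_invariant [FiniteDimensional ℂ M] (t : IsSl2Triple h e f)
    (hirr : ∀ N : Submodule ℂ M,
      (∀ x ∈ N, ⁅e, x⁆ ∈ N ∧ ⁅f, x⁆ ∈ N ∧ ⁅h, x⁆ ∈ N) → N = ⊥ ∨ N = ⊤)
    (h1 : finrank ℂ M ≠ 1) (h3 : finrank ℂ M ≠ 3)
    (hdec : ∀ y : 𝔤, ∃ (a b c : ℂ) (z : 𝔤), y = a • e + b • f + c • h + z ∧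
      ⁅e, z⁆ = 0 ∧ ⁅f, z⁆ = 0 ∧ ⁅h, z⁆ = 0)
    (T : 𝔤 →ₗ[ℂ] M) (he : ⁅e, T⁆ = 0) (hf : ⁅f, T⁆ = 0) (hh : ⁅h, T⁆ = 0) : T = 0 := by
  have hT : ∀ x : 𝔤, ⁅x, T⁆ = 0 → ∀ y, ⁅x, T y⁆ = T ⁅x, y⁆ := fun x hx y =>
    sub_eq_zero.1 (by rw [← LieHom.lie_apply, hx, LinearMap.zero_apply])
  -- Such a vector, if nonzero, is primitive of weight 0, which makes `M` one-dimensional.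
  have hinv : ∀ v : M, ⁅e, v⁆ = 0 → ⁅h, v⁆ = 0 → v = 0 := by
    intro v hev hhv
    by_contra hv
    obtain ⟨n, b, hn, -⟩ := HasPrimitiveVectorWith.exists_basis
      (t := t) (μ := 0) ⟨hv, by rw [hhv, zero_smul], hev⟩ hirr
    have hn0 : n = 0 := by exact_mod_cast hn.symm
    exact h1 (by rw [finrank_eq_card_basis b, hn0, Fintype.card_fin])
  -- By equivariance `T e` is killed by `e` and has weight 2; if nonzero it generates a module of
  -- dimension 3. The vanishing then descends to `h` and `f` by applying `f`.
  have hTe : T e = 0 := by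
    by_contra hv
    obtain ⟨n, b, hn, -⟩ := HasPrimitiveVectorWith.exists_basis
      (t := t) (μ := 2) ⟨hv, by rw [hT h hh, t.lie_h_e_smul ℂ, map_smul],
        by rw [hT e he, lie_self, map_zero]⟩ hirr
    have hn2 : n = 2 := by exact_mod_cast hn.symm
    exact h3 (by rw [finrank_eq_card_basis b, hn2, Fintype.card_fin])
  have hTh : T h = 0 := by
    rw [← t.lie_e_f, ← lie_skew, map_neg, ← hT f hf, hTe, lie_zero, neg_zero]
  have hTf : T f = 0 := by
    have h2 : (2 : ℂ) • T f = 0 := by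
      rw [← map_smul, ← neg_eq_zero, ← map_neg, ← t.lie_lie_smul_f ℂ, ← lie_skew, map_neg,
        ← hT f hf, hTh, lie_zero, neg_zero]
    simpa using h2
  refine LinearMap.ext fun y => ?_
  obtain ⟨a, b, c, z, rfl, hez, -, hhz⟩ := hdec y
  have hTz : T z = 0 := hinv _ (by rw [hT e he, hez, map_zero]) (by rw [hT h hh, hhz, map_zero])
  simp [hTe, hTf, hTh, hTz]

end Modules

end IsSl2Triple

/-! ### Splitting the extension of `L/I` by `I`. -/

namespace LeibnizAlgebra

section Lift

variable {L : Type*} [AddCommGroup L] [Module ℂ L] [LeibnizAlgebra L]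

theorem toAssocLie_bracket (x y : L) :
    toAssocLie L ⁅x, y⁆ = ⁅toAssocLie L x, toAssocLie L y⁆ := rfl

theorem toAssocLie_eq_zero {x : L} : toAssocLie L x = 0 ↔ x ∈ squaresIdeal L :=
  Submodule.Quotient.mk_eq_zero _

/-- The Leibniz identity makes the right action an anti-representation, whence the sign in the left
module structure below. -/
theorem rightAction_bracket (p q : AssocLie L) (x : squaresIdeal L) :
    rightAction L ⁅p, q⁆ x =
      rightAction L q (rightAction L p x) - rightAction L p (rightAction L q x) := by
  obtain ⟨a, rfl⟩ := toAssocLie_surjective L p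
  obtain ⟨b, rfl⟩ := toAssocLie_surjective L q
  exact Subtype.ext (leibniz (x : L) a b)

/-- The ideal generated by squares as a left Lie module over `L/I`: the class of `l` sends `x` to
`-[x,l]`. -/
instance : LieRingModule (AssocLie L) (squaresIdeal L) where
  bracket q x := -rightAction L q x
  add_lie p q x := by
    change -rightAction L (p + q) x = -rightAction L p x + -rightAction L q x
    rw [map_add, LinearMap.add_apply, neg_add]
  lie_add q x y := by
    change -rightAction L q (x + y) = -rightAction L q x + -rightAction L q y
    rw [map_add, neg_add]
  leibniz_lie p q x := by
    change -rightAction L p (-rightAction L q x) =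
      -rightAction L ⁅p, q⁆ x + -rightAction L q (-rightAction L p x)
    rw [rightAction_bracket, map_neg, map_neg]
    abel

theorem lie_eq_neg_rightAction (q : AssocLie L) (x : squaresIdeal L) :
    ⁅q, x⁆ = -rightAction L q x := rfl

instance : LieModule ℂ (AssocLie L) (squaresIdeal L) where
  smul_lie c q x := by
    simp only [lie_eq_neg_rightAction, map_smul, LinearMap.smul_apply, smul_neg]
  lie_smul c q x := by
    simp only [lie_eq_neg_rightAction, map_smul, smul_neg]

theorem bracket_eq_neg_lie (x : squaresIdeal L) (l : L) :
    ⁅(x : L), l⁆ = -((⁅toAssocLie L l, x⁆ : squaresIdeal L) : L) := by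
  rw [lie_eq_neg_rightAction, Submodule.coe_neg, neg_neg, rightAction_mk]

theorem neg_bracket (x y : L) : ⁅-x, y⁆ = -⁅x, y⁆ := LinearMap.map_neg₂ (bracketHom L) x y

theorem sub_bracket (x y z : L) : ⁅x - y, z⁆ = ⁅x, z⁆ - ⁅y, z⁆ :=
  LinearMap.map_sub₂ (bracketHom L) x y z

theorem bracket_sub (x y z : L) : ⁅x, y - z⁆ = ⁅x, y⁆ - ⁅x, z⁆ := map_sub (bracketHom L x) y z

/-- The defect of a linear section of `L → L/I` from being multiplicative. -/
def sectionDefect (σ : AssocLie L →ₗ[ℂ] L) (hσ : ∀ q, toAssocLie L (σ q) = q) :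
    AssocLie L →ₗ[ℂ] AssocLie L →ₗ[ℂ] squaresIdeal L :=
  LinearMap.mk₂ ℂ
    -- The right factor `q` comes first, so that the defect is a map from `L/I` to `Hom(L/I, I)`.
    (fun q p => ⟨⁅σ p, σ q⁆ - σ ⁅p, q⁆, toAssocLie_eq_zero.1 (by
      rw [map_sub, toAssocLie_bracket, hσ, hσ, hσ, sub_self])⟩)
    (fun q q' p => Subtype.ext (by
      simp only [map_add, lie_add, bracket_add, Submodule.coe_add]; abel))
    (fun c q p => Subtype.ext (by
      simp only [map_smul, lie_smul, bracket_smul, Submodule.coe_smul, smul_sub]))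
    (fun q p p' => Subtype.ext (by
      simp only [map_add, add_lie, add_bracket, Submodule.coe_add]; abel))
    (fun c q p => Subtype.ext (by
      simp only [map_smul, smul_lie, smul_bracket, Submodule.coe_smul, smul_sub]))

theorem coe_sectionDefect (σ : AssocLie L →ₗ[ℂ] L) (hσ : ∀ q, toAssocLie L (σ q) = q)
    (p q : AssocLie L) : (sectionDefect σ hσ q p : L) = ⁅σ p, σ q⁆ - σ ⁅p, q⁆ := rfl

/-- This is the Leibniz identity for `σ x`, `σ y`, `σ z`. In a right entry `σ [y, z]` may be
replaced by `[σ y, σ z]`, because they differ by an element of `I`; the terms lying in the image of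
`σ` cancel by the Jacobi identity of `L/I`. -/
theorem sectionDefect_cocycle (σ : AssocLie L →ₗ[ℂ] L) (hσ : ∀ q, toAssocLie L (σ q) = q)
    (y z : AssocLie L) :
    sectionDefect σ hσ ⁅y, z⁆ = ⁅y, sectionDefect σ hσ z⁆ - ⁅z, sectionDefect σ hσ y⁆ := by
  refine LinearMap.ext fun x => Subtype.ext ?_
  have hact : ∀ (w : AssocLie L) (v : squaresIdeal L),
      ((⁅w, v⁆ : squaresIdeal L) : L) = -⁅(v : L), σ w⁆ := fun w v => by
    rw [bracket_eq_neg_lie, hσ, neg_neg]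
  have hright : ⁅σ x, σ ⁅y, z⁆⁆ = ⁅σ x, ⁅σ y, σ z⁆⁆ := by
    have := bracket_eq_zero_of_mem (σ x) (sectionDefect σ hσ z y).2
    rw [coe_sectionDefect, bracket_sub, sub_eq_zero] at this
    exact this.symm
  rw [LinearMap.sub_apply, LieHom.lie_apply, LieHom.lie_apply]
  simp only [AddSubgroupClass.coe_sub, coe_sectionDefect, hact, sub_bracket, hright, leibniz]
  have hj : σ ⁅x, ⁅y, z⁆⁆ = -σ ⁅⁅y, x⁆, z⁆ + σ ⁅⁅z, x⁆, y⁆ := by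
    rw [← map_neg, ← map_add]
    congr 1
    rw [leibniz_lie x y z, ← lie_skew y x, neg_lie, ← lie_skew y ⁅x, z⁆, ← lie_skew z x, neg_lie]
    abel
  rw [hj, ← lie_skew x y, ← lie_skew x z]
  simp only [map_neg, neg_bracket]
  abel

/-- If the first cohomology of `L/I` with values in `Hom(L/I, I)` vanishes, then the projection
`L → L/I` has a multiplicative section. -/
theorem exists_multiplicative_section
    (H : ∀ D : AssocLie L →ₗ[ℂ] AssocLie L →ₗ[ℂ] squaresIdeal L,
      (∀ y z, D ⁅y, z⁆ = ⁅y, D z⁆ - ⁅z, D y⁆) → ∃ T, ∀ y, D y = ⁅y, T⁆) :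
    ∃ σ : AssocLie L →ₗ[ℂ] L, (∀ q, toAssocLie L (σ q) = q) ∧
      ∀ p q, ⁅σ p, σ q⁆ = σ ⁅p, q⁆ := by
  obtain ⟨σ, hσ⟩ := (toAssocLie L).exists_rightInverse_of_surjective
    (LinearMap.range_eq_top.2 (toAssocLie_surjective L))
  replace hσ : ∀ q, toAssocLie L (σ q) = q := fun q => LinearMap.congr_fun hσ q
  obtain ⟨T, hT⟩ := H (sectionDefect σ hσ) (sectionDefect_cocycle σ hσ)
  -- As `[L, I] = 0`, adding `T` changes `[σ p, σ q]` by `[T p, σ q] = -q·T p`. With `D(q)(p) = q·T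
  -- p - T [q, p]` the sum is `σ [p, q] + T [p, q]`.
  refine ⟨σ + (squaresIdeal L).subtype ∘ₗ T, fun q => ?_, fun p q => ?_⟩
  · rw [LinearMap.add_apply, map_add, hσ]
    exact add_eq_left.2 (toAssocLie_eq_zero.2 (T q).2)
  · have h1 := congrArg (fun v : squaresIdeal L => (v : L)) (LinearMap.congr_fun (hT q) p)
    simp only [coe_sectionDefect, LieHom.lie_apply, AddSubgroupClass.coe_sub] at h1
    simp only [LinearMap.add_apply, LinearMap.comp_apply, Submodule.subtype_apply, add_bracket,
      bracket_add, bracket_eq_zero_of_mem _ (T q).2, bracket_eq_neg_lie (T p) (σ q), hσ, add_zero]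
    rw [sub_eq_iff_eq_add.1 h1, ← lie_skew p q]
    simp only [map_neg, Submodule.coe_neg]
    abel

end Lift

end LeibnizAlgebra

/-! ### Standard frames of `L/I` and Schur's lemma. -/

namespace LeibnizAlgebra

/-- Elements of a Lie algebra that satisfy the relations of the standard basis of
`sl₂ ⊕ ⋯ ⊕ sl₂ ⊕ R`, where `R` is the two-dimensional non-abelian Lie algebra. -/
structure IsStandardFrame {𝔤 : Type*} [LieRing 𝔤] [LieAlgebra ℂ 𝔤] {s : ℕ} (e f h : Fin s → 𝔤)
    (y₁ y₂ : 𝔤) : Prop where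
  lie_e_e : ∀ i j, ⁅e i, e j⁆ = 0
  lie_f_f : ∀ i j, ⁅f i, f j⁆ = 0
  lie_h_h : ∀ i j, ⁅h i, h j⁆ = 0
  lie_e_h : ∀ i j, ⁅e i, h j⁆ = if i = j then (2 : ℂ) • e i else 0
  lie_h_f : ∀ i j, ⁅h i, f j⁆ = if i = j then (2 : ℂ) • f i else 0
  lie_e_f : ∀ i j, ⁅e i, f j⁆ = if i = j then h i else 0
  lie_e_y₁ : ∀ i, ⁅e i, y₁⁆ = 0
  lie_e_y₂ : ∀ i, ⁅e i, y₂⁆ = 0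
  lie_f_y₁ : ∀ i, ⁅f i, y₁⁆ = 0
  lie_f_y₂ : ∀ i, ⁅f i, y₂⁆ = 0
  lie_h_y₁ : ∀ i, ⁅h i, y₁⁆ = 0
  lie_h_y₂ : ∀ i, ⁅h i, y₂⁆ = 0
  lie_y₁_y₂ : ⁅y₁, y₂⁆ = y₁
  h_ne_zero : ∀ i, h i ≠ 0
  span_eq_top : Submodule.span ℂ (Set.range e ∪ Set.range f ∪ Set.range h ∪ {y₁, y₂}) = ⊤
  -- Stands in for linear independence: surjectivity and a dimension count suffice later.
  finrank_eq : finrank ℂ 𝔤 = 3 * s + 2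

namespace IsStandardFrame

variable {𝔤 : Type*} [LieRing 𝔤] [LieAlgebra ℂ 𝔤] {s : ℕ} {e f h : Fin s → 𝔤} {y₁ y₂ : 𝔤}

theorem lie_h_e (B : IsStandardFrame e f h y₁ y₂) (i j : Fin s) :
    ⁅h i, e j⁆ = if i = j then (-2 : ℂ) • e i else 0 := by
  rw [← lie_skew, B.lie_e_h]
  by_cases hij : i = j
  · subst hij; simp
  · simp [hij, Ne.symm hij]

theorem lie_f_h (B : IsStandardFrame e f h y₁ y₂) (i j : Fin s) :
    ⁅f i, h j⁆ = if i = j then (-2 : ℂ) • f i else 0 := by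
  rw [← lie_skew, B.lie_h_f]
  by_cases hij : i = j
  · subst hij; simp
  · simp [hij, Ne.symm hij]

theorem lie_f_e (B : IsStandardFrame e f h y₁ y₂) (i j : Fin s) :
    ⁅f i, e j⁆ = if i = j then -h i else 0 := by
  rw [← lie_skew, B.lie_e_f]
  by_cases hij : i = j
  · subst hij; simp
  · simp [hij, Ne.symm hij]

/-- The table has `[e, h] = 2e` where `IsSl2Triple` wants `[h, e] = 2e`, hence the signs on `h` and
`f`. They fit the left action on `I`, where `-f` and `-h` act as the right brackets with `f` and
`h`. -/
theorem isSl2Triple (B : IsStandardFrame e f h y₁ y₂) (i : Fin s) :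
    IsSl2Triple (-h i) (e i) (-f i) where
  h_ne_zero := neg_ne_zero.2 (B.h_ne_zero i)
  lie_e_f := by rw [lie_neg, B.lie_e_f, if_pos rfl]
  lie_h_e_nsmul := by rw [neg_lie, B.lie_h_e, if_pos rfl]; module
  lie_h_f_nsmul := by rw [neg_lie, lie_neg, B.lie_h_f, if_pos rfl]; module

theorem induction_on (B : IsStandardFrame e f h y₁ y₂) {p : 𝔤 → Prop} (x : 𝔤)
    (he : ∀ i, p (e i)) (hf : ∀ i, p (f i)) (hh : ∀ i, p (h i)) (h₁ : p y₁) (h₂ : p y₂)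
    (h0 : p 0) (hadd : ∀ x y, p x → p y → p (x + y)) (hsmul : ∀ (c : ℂ) x, p x → p (c • x)) :
    p x := by
  have hx : x ∈ Submodule.span ℂ (Set.range e ∪ Set.range f ∪ Set.range h ∪ {y₁, y₂}) := by
    rw [B.span_eq_top]; trivial
  induction hx using Submodule.span_induction with
  | zero => exact h0
  | add x y _ _ hx hy => exact hadd x y hx hy
  | smul c x _ hx => exact hsmul c x hx
  | mem x hx =>
    rcases hx with ((⟨i, rfl⟩ | ⟨i, rfl⟩) | ⟨i, rfl⟩) | rfl | rfl
    exacts [he i, hf i, hh i, h₁, h₂]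

/-- Frame vectors outside the `i`-th triple commute with it. This is the decomposition used by
`cocycle_eq_coboundary`. -/
theorem exists_eq_add_centralizer (B : IsStandardFrame e f h y₁ y₂) (i : Fin s) (y : 𝔤) :
    ∃ (a b c : ℂ) (z : 𝔤), y = a • e i + b • (-f i) + c • (-h i) + z ∧
      ⁅e i, z⁆ = 0 ∧ ⁅-f i, z⁆ = 0 ∧ ⁅-h i, z⁆ = 0 := by
  induction y using B.induction_on with
  | he j =>
    by_cases hij : i = j
    · subst hij; exact ⟨1, 0, 0, 0, by simp, by simp, by simp, by simp⟩
    · exact ⟨0, 0, 0, e j, by simp, by simp [B.lie_e_e], by simp [B.lie_f_e, hij],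
        by simp [B.lie_h_e, hij]⟩
  | hf j =>
    by_cases hij : i = j
    · subst hij; exact ⟨0, -1, 0, 0, by simp, by simp, by simp, by simp⟩
    · exact ⟨0, 0, 0, f j, by simp, by simp [B.lie_e_f, hij], by simp [B.lie_f_f],
        by simp [B.lie_h_f, hij]⟩
  | hh j =>
    by_cases hij : i = j
    · subst hij; exact ⟨0, 0, -1, 0, by simp, by simp, by simp, by simp⟩
    · exact ⟨0, 0, 0, h j, by simp, by simp [B.lie_e_h, hij], by simp [B.lie_f_h, hij],
        by simp [B.lie_h_h]⟩
  | h₁ => exact ⟨0, 0, 0, y₁, by simp, by simp [B.lie_e_y₁], by simp [B.lie_f_y₁],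
      by simp [B.lie_h_y₁]⟩
  | h₂ => exact ⟨0, 0, 0, y₂, by simp, by simp [B.lie_e_y₂], by simp [B.lie_f_y₂],
      by simp [B.lie_h_y₂]⟩
  | h0 => exact ⟨0, 0, 0, 0, by simp, by simp, by simp, by simp⟩
  | hadd x y hx hy =>
    obtain ⟨a, b, c, z, rfl, h1, h2, h3⟩ := hx
    obtain ⟨a', b', c', z', rfl, h1', h2', h3'⟩ := hy
    exact ⟨a + a', b + b', c + c', z + z', by module, by rw [lie_add, h1, h1', add_zero],
      by rw [lie_add, h2, h2', add_zero], by rw [lie_add, h3, h3', add_zero]⟩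
  | hsmul r x hx =>
    obtain ⟨a, b, c, z, rfl, h1, h2, h3⟩ := hx
    exact ⟨r * a, r * b, r * c, r • z, by module, by rw [lie_smul, h1, smul_zero],
      by rw [lie_smul, h2, smul_zero], by rw [lie_smul, h3, smul_zero]⟩

end IsStandardFrame

/-- Schur's lemma: an element centralizing an `sl₂`-triple acts by a scalar on a module that is
irreducible over the triple. -/
theorem exists_lie_eq_smul_of_irreducible {𝔤 M : Type*} [LieRing 𝔤] [LieAlgebra ℂ 𝔤]
    [AddCommGroup M] [Module ℂ M] [LieRingModule 𝔤 M] [LieModule ℂ 𝔤 M] [FiniteDimensional ℂ M]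
    [Nontrivial M] {e f h z : 𝔤}
    (hirr : ∀ N : Submodule ℂ M,
      (∀ x ∈ N, ⁅e, x⁆ ∈ N ∧ ⁅f, x⁆ ∈ N ∧ ⁅h, x⁆ ∈ N) → N = ⊥ ∨ N = ⊤)
    (he : ⁅e, z⁆ = 0) (hf : ⁅f, z⁆ = 0) (hh : ⁅h, z⁆ = 0) :
    ∃ c : ℂ, ∀ v : M, ⁅z, v⁆ = c • v := by
  obtain ⟨c, hc⟩ := Module.End.exists_eigenvalue (LieModule.toEnd ℂ 𝔤 M z)
  have hmem : ∀ v, v ∈ (LieModule.toEnd ℂ 𝔤 M z).eigenspace c ↔ ⁅z, v⁆ = c • v := fun v =>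
    Module.End.mem_eigenspace_iff
  have hcomm : ∀ x : 𝔤, ⁅x, z⁆ = 0 → ∀ v : M, ⁅z, v⁆ = c • v → ⁅z, ⁅x, v⁆⁆ = c • ⁅x, v⁆ := by
    intro x hx v hv
    rw [leibniz_lie, ← lie_skew, hx, neg_zero, zero_lie, zero_add, hv, lie_smul]
  refine ⟨c, fun v => (hmem v).1 ?_⟩
  have htop : (LieModule.toEnd ℂ 𝔤 M z).eigenspace c = ⊤ := by
    refine (hirr _ fun x hx => ?_).resolve_left hc
    simp only [hmem] at hx ⊢
    exact ⟨hcomm e he x hx, hcomm f hf x hx, hcomm h hh x hx⟩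
  rw [htop]
  trivial

/-- Scalars commute. It applies to `e_j`, `f_j`, `h_j` with `j ≠ 0` and to `y₁`, each of which is up
to a factor a bracket of elements centralizing the first `sl₂`. -/
theorem lie_lie_eq_zero_of_scalar {𝔤 M : Type*} [LieRing 𝔤] [LieAlgebra ℂ 𝔤]
    [AddCommGroup M] [Module ℂ M] [LieRingModule 𝔤 M] [LieModule ℂ 𝔤 M] {z w : 𝔤}
    (hz : ∃ c : ℂ, ∀ v : M, ⁅z, v⁆ = c • v) (hw : ∃ c : ℂ, ∀ v : M, ⁅w, v⁆ = c • v) (v : M) :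
    ⁅⁅z, w⁆, v⁆ = 0 := by
  obtain ⟨c, hc⟩ := hz
  obtain ⟨d, hd⟩ := hw
  rw [lie_lie, hc, hd, hd, hc, smul_comm, sub_self]

/-! ### The isomorphism with the model. -/

section Model

open BasisIndex Finsupp

/-- The labels of the basis, sorted into a disjoint union. -/
def BasisIndex.equivSum (s m : ℕ) :
    BasisIndex s m ≃ Fin s ⊕ Fin s ⊕ Fin s ⊕ Fin (m + 1) ⊕ Fin 2 where
  toFun
    | e j => .inl j
    | f j => .inr (.inl j)
    | h j => .inr (.inr (.inl j))
    | x k => .inr (.inr (.inr (.inl k)))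
    | y₁ => .inr (.inr (.inr (.inr 0)))
    | y₂ => .inr (.inr (.inr (.inr 1)))
  invFun
    | .inl j => e j
    | .inr (.inl j) => f j
    | .inr (.inr (.inl j)) => h j
    | .inr (.inr (.inr (.inl k))) => x k
    | .inr (.inr (.inr (.inr 0))) => y₁
    | .inr (.inr (.inr (.inr 1))) => y₂
  left_inv i := by cases i <;> rfl
  right_inv i := by
    rcases i with i | i | i | i | i <;> try rfl
    fin_cases i <;> rfl

instance (s m : ℕ) : Fintype (BasisIndex s m) := Fintype.ofEquiv _ (BasisIndex.equivSum s m).symm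

theorem BasisIndex.card (s m : ℕ) : Fintype.card (BasisIndex s m) = 3 * s + 2 + (m + 1) := by
  rw [Fintype.card_congr (BasisIndex.equivSum s m)]
  simp
  ring

variable {L : Type*} [AddCommGroup L] [Module ℂ L] [LeibnizAlgebra L]

theorem finrank_eq_add [FiniteDimensional ℂ L] :
    finrank ℂ L = finrank ℂ (AssocLie L) + finrank ℂ (squaresIdeal L) :=
  (Submodule.finrank_quotient_add_finrank (squaresIdeal L)).symm

/-- A linear map from the model that is multiplicative on the basis is multiplicative. -/
theorem map_tableBracket (s m : ℕ) [NeZero s] (a : ℂ) (Φ : (BasisIndex s m →₀ ℂ) →ₗ[ℂ] L)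
    (hΦ : ∀ p q, Φ (table s m a p q) = ⁅Φ (single p 1), Φ (single q 1)⁆)
    (u v : BasisIndex s m →₀ ℂ) : Φ (tableBracket s m a u v) = ⁅Φ u, Φ v⁆ := by
  have : (tableBracket s m a).compr₂ Φ = (bracketHom L).compl₁₂ Φ Φ := by
    refine Finsupp.lhom_ext' fun p => LinearMap.ext_ring (Finsupp.lhom_ext' fun q =>
      LinearMap.ext_ring ?_)
    have h1 := tableBracket_single s m a p q 1 1
    rw [one_mul, one_smul] at h1
    change Φ (tableBracket s m a (single p 1) (single q 1)) = ⁅Φ (single p 1), Φ (single q 1)⁆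
    rw [h1, hΦ]
  exact LinearMap.congr_fun₂ this u v

/-- The images of the basis vectors of the model in a Leibniz algebra that splits over its ideal
of squares. -/
def basisImage {s m : ℕ} (σ : AssocLie L →ₗ[ℂ] L) (e' f' h' : Fin s → AssocLie L)
    (y₁' y₂' : AssocLie L) (ψ : ℕ → squaresIdeal L) : BasisIndex s m → L
  | e j => σ (e' j)
  | f j => σ (f' j)
  | h j => σ (h' j)
  | x k => ψ k
  | y₁ => σ y₁'
  | y₂ => σ y₂'

/-- A Leibniz algebra which splits over its ideal of squares, with `L/I` and its action on `I`
given by the standard relations, is isomorphic to the model. -/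
theorem nonempty_leibnizEquiv_of_section [FiniteDimensional ℂ L] {s m : ℕ} [NeZero s] {a : ℂ}
    {σ : AssocLie L →ₗ[ℂ] L} (hσ : ∀ q, toAssocLie L (σ q) = q)
    (hmul : ∀ p q, ⁅σ p, σ q⁆ = σ ⁅p, q⁆) {e' f' h' : Fin s → AssocLie L} {y₁' y₂' : AssocLie L}
    (B : IsStandardFrame e' f' h' y₁' y₂') (ψ : ℕ → squaresIdeal L)
    (b : Basis (Fin (m + 1)) ℂ (squaresIdeal L)) (hb : ∀ k, b k = ψ k) (hψ : ψ (m + 1) = 0)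
    (hh : ∀ (k : ℕ) j, ⁅h' j, ψ k⁆ = if j = 0 then -(((m : ℂ) - 2 * k) • ψ k) else 0)
    (hf : ∀ k j, ⁅f' j, ψ k⁆ = if j = 0 then -ψ (k + 1) else 0)
    (he : ∀ (k : ℕ) j, ⁅e' j, ψ k⁆ =
      if j = 0 then ((k : ℂ) * ((m : ℂ) + 1 - k)) • ψ (k - 1) else 0)
    (hy₁ : ∀ k, ⁅y₁', ψ k⁆ = 0) (hy₂ : ∀ k, ⁅y₂', ψ k⁆ = -a • ψ k) :
    Nonempty (LeibnizEquiv L (Model s m a)) := by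
  let Φ : (BasisIndex s m →₀ ℂ) →ₗ[ℂ] L :=
    Finsupp.linearCombination ℂ (basisImage σ e' f' h' y₁' y₂' ψ)
  have hΦ : ∀ p (c : ℂ), Φ (single p c) = c • basisImage σ e' f' h' y₁' y₂' ψ p := fun p c =>
    Finsupp.linearCombination_single ℂ c p
  -- The bound includes `k = m + 1`, where both sides vanish; this covers the product of `x_m` with
  -- `f`.
  have hx : ∀ k, k ≤ m + 1 → Φ (xvec s m k) = ψ k := by
    intro k hk
    unfold xvec
    split_ifs with hk'
    · rw [hΦ, one_smul]; rfl
    · obtain rfl : k = m + 1 := by omega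
      rw [map_zero, hψ]; rfl
  have hxx : ∀ (p : L) (k : ℕ), ⁅p, (ψ k : L)⁆ = 0 := fun p k =>
    bracket_eq_zero_of_mem p (ψ k).2
  have htable : ∀ p q, Φ (table s m a p q) = ⁅Φ (single p 1), Φ (single q 1)⁆ := by
    intro p q
    rw [hΦ, hΦ, one_smul, one_smul]
    have hk1 : ∀ k : Fin (m + 1), (k : ℕ) - 1 ≤ m + 1 := fun k => by omega
    have hk2 : ∀ k : Fin (m + 1), (k : ℕ) + 1 ≤ m + 1 := fun k => by omega
    have hk3 : ∀ k : Fin (m + 1), (k : ℕ) ≤ m + 1 := fun k => by omega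
    have s1 : ∀ i, ⁅y₁', e' i⁆ = 0 := fun i => by rw [← lie_skew, B.lie_e_y₁, neg_zero]
    have s2 : ∀ i, ⁅y₂', e' i⁆ = 0 := fun i => by rw [← lie_skew, B.lie_e_y₂, neg_zero]
    have s3 : ∀ i, ⁅y₁', f' i⁆ = 0 := fun i => by rw [← lie_skew, B.lie_f_y₁, neg_zero]
    have s4 : ∀ i, ⁅y₂', f' i⁆ = 0 := fun i => by rw [← lie_skew, B.lie_f_y₂, neg_zero]
    have s5 : ∀ i, ⁅y₁', h' i⁆ = 0 := fun i => by rw [← lie_skew, B.lie_h_y₁, neg_zero]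
    have s6 : ∀ i, ⁅y₂', h' i⁆ = 0 := fun i => by rw [← lie_skew, B.lie_h_y₂, neg_zero]
    have s7 : ⁅y₂', y₁'⁆ = -y₁' := by rw [← lie_skew, B.lie_y₁_y₂]
    rcases p with i | i | i | k | _ | _ <;> rcases q with j | j | j | l | _ | _ <;>
      simp only [table, basisImage, hmul, hxx, bracket_eq_neg_lie, hσ, he, hf, hh, hy₁, hy₂,
        B.lie_e_e, B.lie_f_f, B.lie_h_h, B.lie_e_h, B.lie_h_f, B.lie_e_f, B.lie_h_e, B.lie_f_h,
        B.lie_f_e, B.lie_e_y₁, B.lie_e_y₂, B.lie_f_y₁, B.lie_f_y₂, B.lie_h_y₁, B.lie_h_y₂,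
        B.lie_y₁_y₂, s1, s2, s3, s4, s5, s6, s7, lie_self] <;>
      (try split_ifs) <;>
      simp [hΦ, hx, hk1, hk2, hk3, basisImage]
  -- The range contains `I` and the image of `σ`, which together span `L`.
  have hsurj : Function.Surjective Φ := by
    rw [← LinearMap.range_eq_top, eq_top_iff]
    have hI : squaresIdeal L ≤ LinearMap.range Φ := by
      intro v hv
      have h1 := b.sum_repr ⟨v, hv⟩
      have h2 := congrArg (squaresIdeal L).subtype h1
      rw [map_sum] at h2
      change _ = v at h2
      rw [← h2]
      refine sum_mem fun k _ => ?_
      rw [map_smul, hb]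
      exact Submodule.smul_mem _ _ ⟨single (x k) 1, by rw [hΦ, one_smul]; rfl⟩
    have hq : ∀ q, σ q ∈ LinearMap.range Φ := by
      intro q
      induction q using B.induction_on with
      | he i => exact ⟨single (e i) 1, by rw [hΦ, one_smul]; rfl⟩
      | hf i => exact ⟨single (f i) 1, by rw [hΦ, one_smul]; rfl⟩
      | hh i => exact ⟨single (h i) 1, by rw [hΦ, one_smul]; rfl⟩
      | h₁ => exact ⟨single y₁ 1, by rw [hΦ, one_smul]; rfl⟩
      | h₂ => exact ⟨single y₂ 1, by rw [hΦ, one_smul]; rfl⟩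
      | h0 => rw [map_zero]; exact zero_mem _
      | hadd p q hp hq => rw [map_add]; exact add_mem hp hq
      | hsmul c q hq => rw [map_smul]; exact Submodule.smul_mem _ c hq
    intro l _
    have h1 : l - σ (toAssocLie L l) ∈ squaresIdeal L :=
      toAssocLie_eq_zero.1 (by rw [map_sub, hσ, sub_self])
    rw [← sub_add_cancel l (σ (toAssocLie L l))]
    exact add_mem (hI h1) (hq _)
  have hdim : finrank ℂ (BasisIndex s m →₀ ℂ) = finrank ℂ L := by
    rw [finrank_eq_add (L := L), B.finrank_eq, finrank_eq_card_basis b, Module.finrank_finsupp_self,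
      BasisIndex.card, Fintype.card_fin]
  let Ψ : Model s m a ≃ₗ[ℂ] L := LinearEquiv.ofBijective Φ
    ⟨(LinearMap.injective_iff_surjective_of_finrank_eq_finrank hdim).2 hsurj, hsurj⟩
  refine ⟨⟨Ψ.symm, fun u v => ?_⟩⟩
  have h1 := map_tableBracket s m a Φ htable (Ψ.symm u) (Ψ.symm v)
  have h2 : Ψ ⁅Ψ.symm u, Ψ.symm v⁆ = ⁅Ψ (Ψ.symm u), Ψ (Ψ.symm v)⁆ := h1
  rw [Ψ.apply_symm_apply, Ψ.apply_symm_apply] at h2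
  exact (Ψ.symm_apply_eq.2 h2.symm)

/-- The classification, in terms of a standard frame of `L/I`. -/
theorem exists_leibnizEquiv_of_frame [FiniteDimensional ℂ L] {s : ℕ} [NeZero s]
    {e' f' h' : Fin s → AssocLie L} {y₁' y₂' : AssocLie L}
    (B : IsStandardFrame e' f' h' y₁' y₂') [Nontrivial (squaresIdeal L)]
    (hirr : ∀ N : Submodule ℂ (squaresIdeal L),
      (∀ x ∈ N, ⁅e' 0, x⁆ ∈ N ∧ ⁅-f' 0, x⁆ ∈ N ∧ ⁅-h' 0, x⁆ ∈ N) → N = ⊥ ∨ N = ⊤)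
    (h1 : finrank ℂ (squaresIdeal L) ≠ 1) (h3 : finrank ℂ (squaresIdeal L) ≠ 3) :
    ∃ (m : ℕ) (a : ℂ), finrank ℂ (squaresIdeal L) = m + 1 ∧
      Nonempty (LeibnizEquiv L (Model s m a)) := by
  have t := B.isSl2Triple 0
  have hdec := B.exists_eq_add_centralizer 0
  have : FiniteDimensional ℂ (AssocLie L) :=
    inferInstanceAs (FiniteDimensional ℂ (L ⧸ squaresIdeal L))
  -- The cocycle theorem is applied to the module `Hom(L/I, I)`.
  obtain ⟨σ, hσ, hmul⟩ := exists_multiplicative_section fun D hD =>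
    t.cocycle_eq_coboundary (fun T => t.hom_eq_zero_of_invariant hirr h1 h3 hdec T) hdec D hD
  obtain ⟨μ, v, -, P⟩ := t.exists_hasPrimitiveVectorWith_mem
    (N := (⊤ : Submodule ℂ (squaresIdeal L))) top_ne_bot (fun _ _ => trivial) fun _ _ => trivial
  obtain ⟨m, b, rfl, hb⟩ := P.exists_basis hirr
  have hscal : ∀ z : AssocLie L, ⁅e' 0, z⁆ = 0 → ⁅f' 0, z⁆ = 0 → ⁅h' 0, z⁆ = 0 →
      ∃ c : ℂ, ∀ v : squaresIdeal L, ⁅z, v⁆ = c • v := fun z hez hfz hhz =>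
    exists_lie_eq_smul_of_irreducible hirr hez (by rw [neg_lie, hfz, neg_zero])
      (by rw [neg_lie, hhz, neg_zero])
  have hse : ∀ j, j ≠ 0 → ∃ c : ℂ, ∀ v : squaresIdeal L, ⁅e' j, v⁆ = c • v := fun j hj =>
    hscal _ (B.lie_e_e _ _) (by rw [B.lie_f_e, if_neg hj.symm]) (by rw [B.lie_h_e, if_neg hj.symm])
  have hsf : ∀ j, j ≠ 0 → ∃ c : ℂ, ∀ v : squaresIdeal L, ⁅f' j, v⁆ = c • v := fun j hj =>
    hscal _ (by rw [B.lie_e_f, if_neg hj.symm]) (B.lie_f_f _ _) (by rw [B.lie_h_f, if_neg hj.symm])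
  have hsh : ∀ j, j ≠ 0 → ∃ c : ℂ, ∀ v : squaresIdeal L, ⁅h' j, v⁆ = c • v := fun j hj =>
    hscal _ (by rw [B.lie_e_h, if_neg hj.symm]) (by rw [B.lie_f_h, if_neg hj.symm]) (B.lie_h_h _ _)
  have hs₁ : ∃ c : ℂ, ∀ v : squaresIdeal L, ⁅y₁', v⁆ = c • v :=
    hscal _ (B.lie_e_y₁ _) (B.lie_f_y₁ _) (B.lie_h_y₁ _)
  have hs₂ : ∃ c : ℂ, ∀ v : squaresIdeal L, ⁅y₂', v⁆ = c • v :=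
    hscal _ (B.lie_e_y₂ _) (B.lie_f_y₂ _) (B.lie_h_y₂ _)
  have he0 : ∀ j, j ≠ 0 → ∀ v : squaresIdeal L, ⁅e' j, v⁆ = 0 := fun j hj v => by
    have := lie_lie_eq_zero_of_scalar (hse j hj) (hsh j hj) v
    rw [B.lie_e_h, if_pos rfl, smul_lie] at this
    exact (smul_eq_zero.1 this).resolve_left two_ne_zero
  have hf0 : ∀ j, j ≠ 0 → ∀ v : squaresIdeal L, ⁅f' j, v⁆ = 0 := fun j hj v => by
    have := lie_lie_eq_zero_of_scalar (hsh j hj) (hsf j hj) v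
    rw [B.lie_h_f, if_pos rfl, smul_lie] at this
    exact (smul_eq_zero.1 this).resolve_left two_ne_zero
  have hh0 : ∀ j, j ≠ 0 → ∀ v : squaresIdeal L, ⁅h' j, v⁆ = 0 := fun j hj v => by
    have := lie_lie_eq_zero_of_scalar (hse j hj) (hsf j hj) v
    rwa [B.lie_e_f, if_pos rfl] at this
  obtain ⟨c, hc⟩ := hs₂
  -- The parameter is `-c` because the left action is minus the right bracket. The vectors are `x_k
  -- = (-f)^k·v`, that is, `v` bracketed `k` times on the right with `f`.
  refine ⟨m, -c, by rw [finrank_eq_card_basis b, Fintype.card_fin],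
    nonempty_leibnizEquiv_of_section hσ hmul B
      (fun k => ((LieModule.toEnd ℂ (AssocLie L) (squaresIdeal L) (-f' 0)) ^ k) v) b hb
      (P.pow_toEnd_f_eq_zero_of_eq_nat rfl) (fun k j => ?_) (fun k j => ?_) (fun k j => ?_)
      (fun k => ?_) fun k => ?_⟩
  · split_ifs with hj
    · subst hj
      rw [← neg_neg (h' 0), neg_lie, P.lie_h_pow_toEnd_f]
    · exact hh0 j hj _
  · split_ifs with hj
    · subst hj
      rw [← P.lie_f_pow_toEnd_f, neg_lie, neg_neg]
    · exact hf0 j hj _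
  · split_ifs with hj
    · subst hj
      -- At `k = 0` the index `k - 1` is truncated to 0, harmlessly, since the coefficient is zero.
      rcases k with _ | k
      · simpa using P.lie_e
      · rw [P.lie_e_pow_succ_toEnd_f, Nat.add_sub_cancel]
        congr 1
        push_cast
        ring
    · exact he0 j hj _
  · have := lie_lie_eq_zero_of_scalar hs₁ ⟨c, hc⟩
      (((LieModule.toEnd ℂ (AssocLie L) (squaresIdeal L) (-f' 0)) ^ k) v)
    rwa [B.lie_y₁_y₂] at this
  · rw [hc, neg_neg]

end Model

end LeibnizAlgebra

/-! ### Concrete frames: matrices in `sl₂` and the two-dimensional algebra `R`. -/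

namespace LeibnizAlgebra

open LieAlgebra.SpecialLinear

theorem finrank_sl_fin_two : finrank ℂ (sl (Fin 2) ℂ) = 3 := by
  have h1 := LinearMap.finrank_range_add_finrank_ker (Matrix.traceLinearMap (Fin 2) ℂ ℂ)
  have h2 : LinearMap.range (Matrix.traceLinearMap (Fin 2) ℂ ℂ) = ⊤ :=
    LinearMap.range_eq_top.2 fun c => ⟨!![c, 0; 0, 0], by simp [Matrix.trace_fin_two]⟩
  rw [h2, finrank_top, finrank_self, Module.finrank_matrix, Fintype.card_fin, finrank_self] at h1
  have h3 : finrank ℂ (sl (Fin 2) ℂ) =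
      finrank ℂ (LinearMap.ker (Matrix.traceLinearMap (Fin 2) ℂ ℂ)) := rfl
  omega

/-- The matrix `!![a, b; c, -a]` as an element of `sl₂`. -/
def slMk (a b c : ℂ) : sl (Fin 2) ℂ :=
  ⟨!![a, b; c, -a], LinearMap.mem_ker.2 (by simp [Matrix.trace_fin_two])⟩

theorem exists_eq_slMk (X : sl (Fin 2) ℂ) : ∃ a b c, X = slMk a b c := by
  refine ⟨X.1 0 0, X.1 0 1, X.1 1 0, Subtype.ext ?_⟩
  have h : X.1 0 0 + X.1 1 1 = 0 := by
    rw [← Matrix.trace_fin_two]; exact LinearMap.mem_ker.1 X.2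
  change X.1 = !![X.1 0 0, X.1 0 1; X.1 1 0, -X.1 0 0]
  conv_lhs => rw [Matrix.eta_fin_two X.1, eq_neg_of_add_eq_zero_right h]

theorem lie_slMk (a b c a' b' c' : ℂ) : ⁅slMk a b c, slMk a' b' c'⁆ =
    slMk (b * c' - b' * c) (2 * (a * b' - a' * b)) (2 * (c * a' - c' * a)) := by
  refine Subtype.ext ?_
  rw [sl_bracket]
  ext i j
  fin_cases i <;> fin_cases j <;> simp [slMk] <;> ring

theorem smul_slMk (r a b c : ℂ) : r • slMk a b c = slMk (r * a) (r * b) (r * c) := by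
  refine Subtype.ext ?_
  change r • !![a, b; c, -a] = !![r * a, r * b; r * c, -(r * a)]
  simp

theorem add_slMk (a b c a' b' c' : ℂ) :
    slMk a b c + slMk a' b' c' = slMk (a + a') (b + b') (c + c') := by
  refine Subtype.ext ?_
  change !![a, b; c, -a] + !![a', b'; c', -a'] = !![a + a', b + b'; c + c', -(a + a')]
  simp [add_comm]

/-- Coordinates in the basis `E`, `-F`, `-H`, where `E`, `F`, `H` are the usual matrices. These
signs give the relations `[e, h] = 2e`, `[h, f] = 2f`, `[e, f] = h` of the table. -/
theorem slMk_eq (a b c : ℂ) :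
    slMk a b c = b • slMk 0 1 0 + (-c) • slMk 0 0 (-1) + (-a) • slMk (-1) 0 0 := by
  simp only [smul_slMk, add_slMk]
  ring_nf

/-- A two-dimensional non-abelian Lie algebra is spanned by `y₁`, `y₂` with `[y₁,y₂] = y₁`. -/
theorem exists_span_of_finrank_eq_two {R : Type*} [LieRing R] [LieAlgebra ℂ R]
    (hdim : finrank ℂ R = 2) (hnonab : ¬ IsLieAbelian R) :
    ∃ y₁ y₂ : R, ⁅y₁, y₂⁆ = y₁ ∧ Submodule.span ℂ {y₁, y₂} = ⊤ := by
  have : FiniteDimensional ℂ R := FiniteDimensional.of_finrank_pos (by omega)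
  let b := finBasisOfFinrankEq ℂ R hdim
  have hrepr : ∀ x : R, x = b.repr x 0 • b 0 + b.repr x 1 • b 1 := fun x => by
    conv_lhs => rw [← b.sum_repr x, Fin.sum_univ_two]
  set z : R := ⁅b 0, b 1⁆ with hz
  -- In dimension two every bracket is a multiple of `z`, the factor being the determinant of the
  -- coordinates.
  have hbr : ∀ x y : R, ⁅x, y⁆ = (b.repr x 0 * b.repr y 1 - b.repr x 1 * b.repr y 0) • z := by
    intro x y
    conv_lhs => rw [hrepr x, hrepr y]
    simp only [add_lie, lie_add, smul_lie, lie_smul, lie_self, ← lie_skew (b 1) (b 0), ← hz]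
    module
  have hz0 : z ≠ 0 := fun h0 => hnonab ⟨fun x y => by rw [hbr, h0, smul_zero]⟩
  -- By the determinant formula `[z, b 1] = z_0 z` and `[z, b 0] = -z_1 z`. Some coordinate of `z`
  -- is nonzero, and rescaling the corresponding basis vector gives `w`.
  have hw : ∃ w : R, ⁅z, w⁆ = z := by
    have hne : b.repr z 0 ≠ 0 ∨ b.repr z 1 ≠ 0 := by
      by_contra! hc
      exact hz0 (by rw [hrepr z, hc.1, hc.2, zero_smul, zero_smul, add_zero])
    rcases hne with hne | hne
    · refine ⟨(b.repr z 0)⁻¹ • b 1, ?_⟩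
      rw [lie_smul, hbr z (b 1), smul_smul]
      simp [hne]
    · refine ⟨-(b.repr z 1)⁻¹ • b 0, ?_⟩
      rw [lie_smul, hbr z (b 0), smul_smul]
      simp [hne]
  obtain ⟨w, hw⟩ := hw
  refine ⟨z, w, hw, ?_⟩
  have hli : LinearIndependent ℂ ![z, w] := by
    rw [LinearIndependent.pair_iff' hz0]
    intro a ha
    rw [← ha, lie_smul, lie_self, smul_zero] at hw
    exact hz0 hw.symm
  have := hli.span_eq_top_of_card_eq_finrank (by simp [hdim])
  rwa [Matrix.range_cons, Matrix.range_cons, Matrix.range_empty, Set.union_empty,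
    Set.singleton_union] at this

open LieAlgebra in
/-- The standard frame of a Lie algebra isomorphic to `sl₂ ⊕ ⋯ ⊕ sl₂ ⊕ R`. -/
theorem isStandardFrame_of_equiv {𝔤 R : Type*} [LieRing 𝔤] [LieAlgebra ℂ 𝔤] [LieRing R]
    [LieAlgebra ℂ R] {s : ℕ} (hdim : finrank ℂ R = 2)
    (φ : 𝔤 ≃ₗ⁅ℂ⁆ ((DirectSum (Fin s) fun _ => sl (Fin 2) ℂ) × R)) {y₁ y₂ : R}
    (hy : ⁅y₁, y₂⁆ = y₁) (hspan : Submodule.span ℂ {y₁, y₂} = ⊤) :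
    IsStandardFrame
      (fun j => φ.symm (DirectSum.of (fun _ : Fin s => sl (Fin 2) ℂ) j (slMk 0 1 0), 0))
      (fun j => φ.symm (DirectSum.of (fun _ : Fin s => sl (Fin 2) ℂ) j (slMk 0 0 (-1)), 0))
      (fun j => φ.symm (DirectSum.of (fun _ : Fin s => sl (Fin 2) ℂ) j (slMk (-1) 0 0), 0))
      (φ.symm (0, y₁)) (φ.symm (0, y₂)) := by
  have hsl : ∀ (i j : Fin s) (X Y : sl (Fin 2) ℂ),
      ⁅φ.symm (DirectSum.of (fun _ : Fin s => sl (Fin 2) ℂ) i X, 0),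
        φ.symm (DirectSum.of (fun _ : Fin s => sl (Fin 2) ℂ) j Y, 0)⁆ =
      if i = j then φ.symm (DirectSum.of (fun _ : Fin s => sl (Fin 2) ℂ) i ⁅X, Y⁆, 0) else 0 := by
    intro i j X Y
    rw [← LieEquiv.map_lie, LieAlgebra.Prod.bracket_apply]
    split_ifs with hij
    · subst hij
      rw [DirectSum.lie_of_same, lie_self]
    · rw [DirectSum.lie_of_of_ne _ hij, lie_self]
      exact map_zero φ.symm
  have hslR : ∀ (i : Fin s) (X : sl (Fin 2) ℂ) (y : R),
      ⁅φ.symm (DirectSum.of (fun _ : Fin s => sl (Fin 2) ℂ) i X, 0), φ.symm (0, y)⁆ = 0 := by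
    intro i X y
    rw [← LieEquiv.map_lie, LieAlgebra.Prod.bracket_apply, lie_zero, zero_lie]
    exact map_zero φ.symm
  have hsmul : ∀ (i : Fin s) (c : ℂ) (X : sl (Fin 2) ℂ),
      φ.symm (DirectSum.of (fun _ : Fin s => sl (Fin 2) ℂ) i (c • X), 0) =
        c • φ.symm (DirectSum.of (fun _ : Fin s => sl (Fin 2) ℂ) i X, 0) := by
    intro i c X
    rw [← map_smul, Prod.smul_mk, smul_zero]
    congr 2
    exact map_smul (DirectSum.lof ℂ (Fin s) (fun _ => sl (Fin 2) ℂ) i) c X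
  have hadd : ∀ (i : Fin s) (X Y : sl (Fin 2) ℂ),
      φ.symm (DirectSum.of (fun _ : Fin s => sl (Fin 2) ℂ) i (X + Y), 0) =
        φ.symm (DirectSum.of (fun _ : Fin s => sl (Fin 2) ℂ) i X, 0) +
        φ.symm (DirectSum.of (fun _ : Fin s => sl (Fin 2) ℂ) i Y, 0) := by
    intro i X Y
    rw [← map_add, Prod.mk_add_mk, add_zero, map_add]
  have hzero : ∀ i : Fin s,
      φ.symm (DirectSum.of (fun _ : Fin s => sl (Fin 2) ℂ) i 0, 0) = 0 := by
    intro i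
    rw [map_zero]; exact map_zero φ.symm
  refine ⟨?_, ?_, ?_, ?_, ?_, ?_, fun _ => hslR _ _ _, fun _ => hslR _ _ _, fun _ => hslR _ _ _,
    fun _ => hslR _ _ _, fun _ => hslR _ _ _, fun _ => hslR _ _ _, ?_, ?_, ?_, ?_⟩
  · intro i j
    rw [hsl, lie_self, hzero, ite_self]
  · intro i j
    rw [hsl, lie_self, hzero, ite_self]
  · intro i j
    rw [hsl, lie_self, hzero, ite_self]
  · intro i j
    rw [hsl, lie_slMk, ← hsmul, smul_slMk]
    norm_num
  · intro i j
    rw [hsl, lie_slMk, ← hsmul, smul_slMk]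
    norm_num
  · intro i j
    rw [hsl, lie_slMk]
    norm_num
  · rw [← LieEquiv.map_lie, LieAlgebra.Prod.bracket_apply, lie_self, hy]
  · intro i h0
    have h1 := φ.symm.injective (h0.trans (map_zero φ.symm).symm)
    have h2 := DirectSum.of_injective (β := fun _ : Fin s => sl (Fin 2) ℂ) i
      ((congrArg Prod.fst h1).trans (map_zero _).symm)
    have h3 := congrFun (congrFun (congrArg Subtype.val h2) 0) 0
    simp [slMk] at h3
  · suffices key : ∀ S : Submodule ℂ 𝔤,
        (∀ j, φ.symm (DirectSum.of (fun _ : Fin s => sl (Fin 2) ℂ) j (slMk 0 1 0), 0) ∈ S) →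
        (∀ j, φ.symm (DirectSum.of (fun _ : Fin s => sl (Fin 2) ℂ) j (slMk 0 0 (-1)), 0) ∈ S) →
        (∀ j, φ.symm (DirectSum.of (fun _ : Fin s => sl (Fin 2) ℂ) j (slMk (-1) 0 0), 0) ∈ S) →
        φ.symm (0, y₁) ∈ S → φ.symm (0, y₂) ∈ S → ∀ g, g ∈ S from
      eq_top_iff.2 fun g _ => key _
        (fun j => Submodule.subset_span (.inl (.inl (.inl ⟨j, rfl⟩))))
        (fun j => Submodule.subset_span (.inl (.inl (.inr ⟨j, rfl⟩))))
        (fun j => Submodule.subset_span (.inl (.inr ⟨j, rfl⟩)))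
        (Submodule.subset_span (.inr (.inl rfl))) (Submodule.subset_span (.inr (.inr rfl))) g
    intro S he hf hh h₁ h₂ g
    have hA : ∀ u : DirectSum (Fin s) fun _ => sl (Fin 2) ℂ, φ.symm (u, 0) ∈ S := by
      intro u
      induction u using DirectSum.induction_on with
      | zero => exact (map_zero φ.symm).symm ▸ zero_mem S
      | of j X =>
        obtain ⟨a, b, c, rfl⟩ := exists_eq_slMk X
        rw [slMk_eq, hadd, hadd, hsmul, hsmul, hsmul]
        exact add_mem (add_mem (S.smul_mem _ (he j)) (S.smul_mem _ (hf j))) (S.smul_mem _ (hh j))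
      | add u v hu hv =>
        have : ((u + v, 0) : (DirectSum (Fin s) fun _ => sl (Fin 2) ℂ) × R) = (u, 0) + (v, 0) := by
          rw [Prod.mk_add_mk, add_zero]
        rw [this, map_add]
        exact add_mem hu hv
    have hR : ∀ r : R, φ.symm (0, r) ∈ S := by
      intro r
      obtain ⟨a, b, rfl⟩ := Submodule.mem_span_pair.1 (hspan.symm ▸ Submodule.mem_top (x := r))
      have : ((0, a • y₁ + b • y₂) : (DirectSum (Fin s) fun _ => sl (Fin 2) ℂ) × R) =
          a • (0, y₁) + b • (0, y₂) := by simp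
      rw [this, map_add, map_smul, map_smul]
      exact add_mem (S.smul_mem _ h₁) (S.smul_mem _ h₂)
    obtain ⟨⟨u, r⟩, rfl⟩ := φ.symm.surjective g
    have : ((u, r) : (DirectSum (Fin s) fun _ => sl (Fin 2) ℂ) × R) = (u, 0) + (0, r) := by simp
    rw [this, map_add]
    exact add_mem (hA u) (hR r)
  · have : FiniteDimensional ℂ R := FiniteDimensional.of_finrank_pos (by omega)
    rw [φ.toLinearEquiv.finrank_eq, Module.finrank_prod, Module.finrank_directSum, hdim]
    simp only [finrank_sl_fin_two, Finset.sum_const, Finset.card_univ, Fintype.card_fin,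
      smul_eq_mul]
    ring

end LeibnizAlgebra

theorem mainTheorem2 {L : Type*} [AddCommGroup L] [Module ℂ L] [LeibnizAlgebra L]
    [FiniteDimensional ℂ L] (s : ℕ) [NeZero s]
    {R : Type*} [LieRing R] [LieAlgebra ℂ R] (hRsolv : LieAlgebra.IsSolvable R)
    (hRdim : finrank ℂ R = 2) (hRnonab : ¬ IsLieAbelian R)
    (φ : LeibnizAlgebra.AssocLie L ≃ₗ⁅ℂ⁆
      ((DirectSum (Fin s) fun _ => LieAlgebra.SpecialLinear.sl (Fin 2) ℂ) × R))
    (hirr : LeibnizAlgebra.SquaresIdealIrreducibleOver L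
      (Set.range fun X : LieAlgebra.SpecialLinear.sl (Fin 2) ℂ =>
        φ.symm (DirectSum.of (fun _ : Fin s => LieAlgebra.SpecialLinear.sl (Fin 2) ℂ) 0 X, 0)))
    (hI₁ : finrank ℂ (LeibnizAlgebra.squaresIdeal L) ≠ 1)
    (hI₃ : finrank ℂ (LeibnizAlgebra.squaresIdeal L) ≠ 3) :
    ∃ (m : ℕ) (a : ℂ), finrank ℂ (LeibnizAlgebra.squaresIdeal L) = m + 1 ∧
      Nonempty (LeibnizEquiv L (LeibnizAlgebra.Model s m a)) := by
  obtain ⟨y₁, y₂, hy, hspan⟩ := LeibnizAlgebra.exists_span_of_finrank_eq_two hRdim hRnonab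
  have B := LeibnizAlgebra.isStandardFrame_of_equiv hRdim φ hy hspan
  obtain ⟨hnt, hirr⟩ := hirr
  refine LeibnizAlgebra.exists_leibnizEquiv_of_frame B (fun N hN => hirr N ?_) hI₁ hI₃
  -- The hypothesis on `N` concerns only `e`, `-f`, `-h` under the left action. Signs do not affect
  -- membership in a subspace, and `X` is a combination of the three, so `N` is stable under all of
  -- `sl₂`.
  rintro _ ⟨X, rfl⟩ x hx
  obtain ⟨he, hf, hh⟩ := hN x hx
  rw [neg_lie, neg_mem_iff] at hf hh
  rw [LeibnizAlgebra.lie_eq_neg_rightAction, neg_mem_iff] at he hf hh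
  obtain ⟨a, b, c, rfl⟩ := LeibnizAlgebra.exists_eq_slMk X
  let ι : LieAlgebra.SpecialLinear.sl (Fin 2) ℂ →ₗ[ℂ] LeibnizAlgebra.AssocLie L :=
    φ.symm.toLinearEquiv.toLinearMap ∘ₗ LinearMap.inl ℂ _ R ∘ₗ
      DirectSum.lof ℂ (Fin s) (fun _ => LieAlgebra.SpecialLinear.sl (Fin 2) ℂ) 0
  change LeibnizAlgebra.rightAction L (ι (LeibnizAlgebra.slMk a b c)) x ∈ N
  rw [LeibnizAlgebra.slMk_eq]
  simp only [map_add, map_smul, LinearMap.add_apply, LinearMap.smul_apply]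
  exact add_mem (add_mem (N.smul_mem _ he) (N.smul_mem _ hf)) (N.smul_mem _ hh)
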